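/- Let $U$ be a set of urelements, with superstructure $V(U)=\bigcup_n V_n(U)$, where $V_0(U)=U$ and $V_{n+1}(U)=V_n(U)\cup\mathcal P(V_n(U))$. Let $D$ be an ultrafilter on a set $I$ and let ${}^*$ denote the transform given by the ultrapower modulo $D$: for $X\in V(U)$, ${}^*X$ is the set of classes of families $I\to X$ under equality $D$-almost everywhere, and an element of ${}^*\mathcal P(X)$, represented by a family $(S_i)_{i\in I}$ of subsets of $X$, is identified with the subset $\{[x_i] : x_i\in S_i \text{ for } D\text{-almost all } i\}$ of ${}^*X$; the subsets of ${}^*X$ of this form are called internal. Each $x\in X$ is sent to ${}^*x$, the class of the constant family. Assume that the ultrapower is an enlargement of $V(U)$, i.e. that the concurrency principle holds: whenever $r\in V(U)$ is a relation with domain $P\in V(U)$ and codomain $Q\in V(U)$ such that for every finite $C\subseteq P$ there is $b\in Q$ with $x\,r\,b$ for all $x\in C$, there is $b\in{}^*Q$ with ${}^*x\;{}^*r\;b$ for all $x\in P$. Let $\mathbb A=(A,\mathcal O)$ be an algebra with $A\subseteq U$, where $\mathcal O$ is an indexed family of arbitrarily many operations on $A$, of arbitrary (finite or infinite) arities, and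 let ${}^*\mathbb A=({}^*A,{}^*\mathcal O)$ be its transform. Write $\mathbb B\le{}^*\mathbb A$ if $B\subseteq{}^*A$ is closed under all the internal operations in ${}^*\mathcal O$, applied to internal tuples of arguments with all entries in $B$. The extension monad of $\mathbb A$ is $$\hat{\mathbb A}=\bigcap\{\mathbb B\le{}^*\mathbb A : \mathbb B \text{ is internal and } {}^*a\in B \text{ for all } a\in A\}.$$ **Theorem.** The following are equivalent: (a) $\mathbb A$ is finitely generated, i.e. some finite $F\subseteq A$ is contained in no subalgebra of $\mathbb A$ other than $\mathbb A$ itself; (b) $\hat{\mathbb A}={}^*\mathbb A$; (c) $\hat{\mathbb A}$ is internal. -/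

import Mathlib

universe u v w z

namespace ExtensionMonad

/-! ### Algebras of urelements -/

/-- A signature: a family of operation symbols, of any size, each with an arity. An arity is
the index set of the arguments (an ordinal, say), and may be empty, finite or infinite. -/
structure Signature where
  Op : Type v
  Arity : Op → Type w

/-- An algebra whose underlying set consists of urelements, that is, elements of `U`. -/
structure UrAlgebra (σ : Signature.{v, w}) (U : Type u) where
  carrier : Set U
  op : (o : σ.Op) → (σ.Arity o → carrier) → carrier

namespace UrAlgebra

variable {σ : Signature.{v, w}} {U : Type u}

/-- `S` is (the underlying set of) a subalgebra. -/
def IsSubalgebra (A : UrAlgebra σ U) (S : Set A.carrier) : Prop :=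
  ∀ (o : σ.Op) (x : σ.Arity o → A.carrier), (∀ k, x k ∈ S) → A.op o x ∈ S

/-- The subalgebra generated by `F`. -/
def generated (A : UrAlgebra σ U) (F : Set A.carrier) : Set A.carrier :=
  ⋂₀ {S | A.IsSubalgebra S ∧ F ⊆ S}

/-- `A` is generated by a finite subset. -/
def FinitelyGenerated (A : UrAlgebra σ U) : Prop :=
  ∃ F : Set A.carrier, F.Finite ∧ A.generated F = Set.univ

end UrAlgebra

/-! ### The ultrapower -/

/-- The `*`-transform of a set `X` (given as a type): the ultrapower of `X`. The transform of
`x : X` is the germ `(x : Star D X)` of the constant family. -/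
abbrev Star {I : Type z} (D : Ultrafilter I) (X : Type u) : Type (max z u) :=
  Filter.Germ (D : Filter I) X

/-- The set of elements of `*X` that an element `s` of `*(𝒫 X)` stands for; this is the collapse
of membership modulo the ultrafilter to actual membership. -/
def collapse {I : Type z} {D : Ultrafilter I} {X : Type u} (s : Star D (Set X)) :
    Set (Star D X) :=
  {x | Filter.Germ.LiftRel (fun (a : X) (S : Set X) => a ∈ S) x s}

/-- The `*`-transform of a subset of `X`. -/
def starSet {I : Type z} (D : Ultrafilter I) {X : Type u} (S : Set X) : Set (Star D X) :=
  collapse (D := D) ((S : Set X) : Star D (Set X))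

/-- A subset of `*X` is internal if it is an element of `*(𝒫 X)`. -/
def IsInternal {I : Type z} {D : Ultrafilter I} {X : Type u} (S : Set (Star D X)) : Prop :=
  ∃ s : Star D (Set X), S = collapse s

/-! ### Enlargements of the superstructure -/

/-- The levels `V₀(U) = U`, `Vₙ₊₁(U) = U ∪ 𝒫(Vₙ(U)) = Vₙ(U) ∪ 𝒫(Vₙ(U))` of the superstructure
`V(U)` over the urelements `U`. Every set in `V(U)` is a subset of some level, and every subset
of a level belongs to `V(U)`. -/
def Level (U : Type u) : ℕ → Type u
  | 0 => U
  | n + 1 => U ⊕ Set (Level U n)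

/-- The relation `r` with domain `P` and codomain `Q` is concurrent: every finite subset of the
domain has an `r`-bound in the codomain. -/
def IsConcurrent {X Y : Type u} (P : Set X) (Q : Set Y) (r : X → Y → Prop) : Prop :=
  ∀ C : Set X, C ⊆ P → C.Finite → ∃ b ∈ Q, ∀ x ∈ C, r x b

/-- The ultrapower of `V(U)` modulo `D` is an enlargement: the concurrency principle holds, that
is, for each concurrent relation `r ∈ V(U)` from `P` to `Q` there is `b ∈ *Q` such that
`*x *r b` for all `x ∈ P`. -/
def IsEnlargement (U : Type u) {I : Type z} (D : Ultrafilter I) : Prop :=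
  ∀ (m n : ℕ) (P : Set (Level U m)) (Q : Set (Level U n)) (r : Level U m → Level U n → Prop),
    IsConcurrent P Q r →
      ∃ b ∈ starSet D Q, ∀ x ∈ P, Filter.Germ.LiftRel r (x : Star D (Level U m)) b

/-! ### The transform of an algebra and the extension monad -/

section Monad

variable {σ : Signature.{v, w}} {U : Type u} {I : Type z}

/-- The pairs consisting of an operation symbol and a tuple of arguments for it. -/
abbrev Application (A : UrAlgebra σ U) : Type (max u v w) :=
  Σ o : σ.Op, (σ.Arity o → A.carrier)

/-- The internal operations of `*A`. An element of `*(Application A)` is an internal operation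
symbol `o` (an element of `*σ.Op`) with an internal tuple of arguments indexed by the internal
arity of `o`; the value is the `*`-transform of the evaluation map `(o, x) ↦ o(x)`. -/
def starOp (A : UrAlgebra σ U) (D : Ultrafilter I) (t : Star D (Application A)) :
    Star D A.carrier :=
  t.map (fun p => A.op p.1 p.2)

/-- `a` is an entry of the internal tuple of arguments in `t`: the `*`-transform of the relation
`a ∈ range x` between `a` and `(o, x)`. -/
def IsEntry (A : UrAlgebra σ U) (D : Ultrafilter I) (a : Star D A.carrier)
    (t : Star D (Application A)) : Prop :=
  Filter.Germ.LiftRel (fun (a : A.carrier) (p : Application A) => a ∈ Set.range p.2) a t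

/-- `B ≤ *A`: the set `B` is closed under all internal operations of `*A` (all of `*O`, not only
the transforms of the operations of `A`), applied to internal tuples. -/
def IsStarSubalgebra (A : UrAlgebra σ U) (D : Ultrafilter I) (B : Set (Star D A.carrier)) :
    Prop :=
  ∀ t : Star D (Application A), (∀ a, IsEntry A D a t → a ∈ B) → starOp A D t ∈ B

/-- The transforms of the operations of `A` restrict to the operations of `A`. Hence, for `A` to
be a subreduct of `B ≤ *A` means just that `B` contains the elements of `A`. -/
theorem starOp_coe (A : UrAlgebra σ U) (D : Ultrafilter I) (o : σ.Op)
    (x : σ.Arity o → A.carrier) :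
    starOp A D ((⟨o, x⟩ : Application A) : Star D (Application A)) =
      ((A.op o x : A.carrier) : Star D A.carrier) :=
  rfl

/-- The extension monad of `A`: the intersection of all internal `B ≤ *A` of which `A` is a
subreduct. -/
def extensionMonad (A : UrAlgebra σ U) (D : Ultrafilter I) : Set (Star D A.carrier) :=
  ⋂₀ {B | IsInternal B ∧ IsStarSubalgebra A D B ∧
    ∀ a : A.carrier, (a : Star D A.carrier) ∈ B}

end Monad

end ExtensionMonad

/-!
Write `gen` for `UrAlgebra.generated`. Two facts about an ultrapower carry the proof. An internal
set `[S i]` is closed under the internal operations exactly if almost every `S i` is a subalgebra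
(`isStarSubalgebra_collapse_iff`), and inclusion of internal sets is inclusion almost everywhere
(`collapse_subset_collapse_iff`). So if a finite set `F` generates `A`, then an internal subalgebra
`[S i]` containing `A` has `F ⊆ S i`, hence `S i = A`, for almost all `i`; it is therefore all
of `*A`.

For the converse, suppose that `A` is not finitely generated but that its extension monad is
internal, say `[T i]`. An enlargement need not be saturated, so one cannot simply ask for an
internal subalgebra that contains `A` and omits a given element of `[T i]`. Instead, one *standard*
function is used that witnesses the failure of finite generation uniformly: a map `g : A → A` such
that no nonempty finite `B` satisfies `g(B) ⊆ gen(B)` (`exists_forall_finite_not_mapsTo_generated`).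
Concurrency provides a hyperfinite set `[K i]` containing `A`. Put
`B i = {a ∈ K i | g a ∈ T i}`. Then `[gen (B i)]` is an internal subalgebra containing `A`,
so by minimality `g(B i) ⊆ T i ⊆ gen (B i)` for almost all `i`. As
`B i` is finite and nonempty for almost all `i`, this is a contradiction.

The map `g` comes from a rank. Passing from `gen` to the union of the `gen(B)` over finite `B ⊆ Y`
turns generation into a finitary closure of `Y`, also if `A` has infinitary operations. Take `Y`
of least cardinality with closure `A`. It is infinite, and in a well-order of least type its
proper initial segments have smaller cardinality, so that their closures are proper subsets of `A`
forming a chain with union `A`. Let `g a` be a point outside of the first of them containing `a`.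
-/

namespace ExtensionMonad

/-! ### Generation by finite sets -/

namespace UrAlgebra

variable {σ : Signature.{v, w}} {U : Type u} (A : UrAlgebra σ U)

theorem isSubalgebra_generated (F : Set A.carrier) : A.IsSubalgebra (A.generated F) :=
  fun o x hx S hS => hS.1 o x fun k => hx k S hS

theorem subset_generated (F : Set A.carrier) : F ⊆ A.generated F :=
  fun _ ha _ hS => hS.2 ha

theorem generated_subset {F S : Set A.carrier} (hS : A.IsSubalgebra S) (h : F ⊆ S) :
    A.generated F ⊆ S :=
  fun _ ha => ha S ⟨hS, h⟩

theorem generated_mono {F G : Set A.carrier} (h : F ⊆ G) : A.generated F ⊆ A.generated G :=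
  A.generated_subset (A.isSubalgebra_generated G) (h.trans (A.subset_generated G))

/-- The finitary part of generation: the elements generated by some finite subset of `Y`. It is a
closure operator which agrees with `generated` on finite sets; in the presence of infinitary
operations it need not yield a subalgebra. -/
def finGenerated (Y : Set A.carrier) : Set A.carrier :=
  {a | ∃ B : Set A.carrier, B.Finite ∧ B ⊆ Y ∧ a ∈ A.generated B}

variable {A}

theorem finGenerated_mono {Y Z : Set A.carrier} (h : Y ⊆ Z) :
    A.finGenerated Y ⊆ A.finGenerated Z :=
  fun _ ⟨B, hB, hBY, ha⟩ => ⟨B, hB, hBY.trans h, ha⟩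

theorem generated_subset_finGenerated {B Y : Set A.carrier} (hB : B.Finite)
    (h : B ⊆ A.finGenerated Y) : A.generated B ⊆ A.finGenerated Y := by
  have h' : ∀ b ∈ B, ∃ c : Set A.carrier, c.Finite ∧ c ⊆ Y ∧ b ∈ A.generated c := fun _ hb => h hb
  choose! c hc hcY hac using h'
  intro a ha
  refine ⟨⋃ b ∈ B, c b, hB.biUnion hc, Set.iUnion₂_subset hcY, ?_⟩
  refine A.generated_subset (A.isSubalgebra_generated _) (fun b hb => ?_) ha
  exact A.generated_mono (Set.subset_biUnion_of_mem hb) (hac b hb)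

theorem FinitelyGenerated.of_finGenerated_eq_univ {Y : Set A.carrier} (hY : Y.Finite)
    (h : A.finGenerated Y = Set.univ) : A.FinitelyGenerated := by
  refine ⟨Y, hY, Set.eq_univ_of_forall fun a => ?_⟩
  obtain ⟨B, -, hBY, ha⟩ : a ∈ A.finGenerated Y := h ▸ Set.mem_univ a
  exact A.generated_mono hBY ha

/-- If `A` is not finitely generated, then a single function witnesses this for all finite
subsets at once. -/
theorem exists_forall_finite_not_mapsTo_generated (hA : ¬ A.FinitelyGenerated) :
    ∃ g : A.carrier → A.carrier, ∀ B : Set A.carrier, B.Finite → B.Nonempty →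
      ¬ Set.MapsTo g B (A.generated B) := by
  obtain ⟨Y, hYA, hYmin⟩ : ∃ Y : Set A.carrier, A.finGenerated Y = Set.univ ∧
      ∀ Z : Set A.carrier, Cardinal.mk Z < Cardinal.mk Y → A.finGenerated Z ≠ Set.univ := by
    have huniv : A.finGenerated Set.univ = Set.univ := Set.eq_univ_of_forall fun a =>
      ⟨{a}, Set.finite_singleton a, Set.subset_univ _, A.subset_generated _ rfl⟩
    have hwf := (InvImage.wf (fun Z : Set A.carrier => Cardinal.mk Z) Cardinal.lt_wf)
    obtain ⟨Y, hY, hmin⟩ := hwf.has_min {Z | A.finGenerated Z = Set.univ} ⟨_, huniv⟩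
    exact ⟨Y, hY, fun Z hZ h => hmin Z h hZ⟩
  have hYinf : Y.Infinite := fun h => hA (.of_finGenerated_eq_univ h hYA)
  obtain ⟨_, _, hrY⟩ := Cardinal.exists_ord_eq_type_lt Y
  have hwf : WellFounded ((· < ·) : Y → Y → Prop) := wellFounded_lt
  -- The closures of the proper initial segments of `Y`.
  let C : Y → Set A.carrier := fun y => A.finGenerated (Subtype.val '' Set.Iic y)
  have hCmono : Monotone C := fun y z hyz =>
    finGenerated_mono (Set.image_mono (Set.Iic_subset_Iic.2 hyz))
  have hCne : ∀ y, C y ≠ Set.univ := by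
    intro y
    apply hYmin
    have hinf : Cardinal.aleph0 ≤ Cardinal.mk Y := Cardinal.infinite_iff.1 hYinf.to_subtype
    have hlt : Cardinal.mk (Set.Iio y) < Cardinal.mk Y := Cardinal.mk_Iio_lt y hrY
    rw [Cardinal.mk_image_eq Subtype.val_injective, ← Set.Iio_insert]
    refine Cardinal.mk_insert_le.trans_lt ?_
    exact Cardinal.add_lt_of_lt hinf hlt (Cardinal.one_lt_aleph0.trans_le hinf)
  have hCex : ∀ a, ∃ y, a ∈ C y := by
    intro a
    obtain ⟨B, hB, hBY, ha⟩ : a ∈ A.finGenerated Y := hYA ▸ Set.mem_univ a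
    have : Nonempty Y := hYinf.nonempty.to_subtype
    obtain ⟨y, hy⟩ := (hB.preimage (Subtype.val_injective (p := (· ∈ Y))).injOn).bddAbove
    exact ⟨y, B, hB, fun b hb => ⟨⟨b, hBY hb⟩, hy hb, rfl⟩, ha⟩
  let ρ : A.carrier → Y := fun a => hwf.min {y | a ∈ C y} (hCex a)
  have hρ : ∀ a, a ∈ C (ρ a) := fun a => hwf.min_mem {y | a ∈ C y} (hCex a)
  choose g hg using fun a => (Set.ne_univ_iff_exists_notMem _).1 (hCne (ρ a))
  refine ⟨g, fun B hB hBne hmaps => ?_⟩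
  -- An element of largest rank is mapped out of the closure of the segment that contains `B`.
  obtain ⟨a, ha, hmax⟩ := Set.exists_max_image B ρ hB hBne
  exact hg a (generated_subset_finGenerated hB (fun b hb => hCmono (hmax b hb) (hρ b))
    (hmaps ha))

end UrAlgebra

/-! ### Internal sets -/

section Internal

variable {I : Type z} {D : Ultrafilter I} {X : Type u}

theorem coe_mem_collapse_coe {f : I → X} {S : I → Set X} :
    ((f : Star D X) ∈ collapse (S : Star D (Set X))) ↔ ∀ᶠ i in (D : Filter I), f i ∈ S i :=
  Iff.rfl

theorem collapse_subset_collapse_iff {S T : I → Set X} :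
    collapse (S : Star D (Set X)) ⊆ collapse (T : Star D (Set X)) ↔
      ∀ᶠ i in (D : Filter I), S i ⊆ T i := by
  refine ⟨fun h => ?_, fun h x => ?_⟩
  · by_contra hne
    have hne := Ultrafilter.eventually_not.2 hne
    obtain ⟨j, hj⟩ := hne.exists
    obtain ⟨x₀, -⟩ := Set.not_subset.1 hj
    have hex : ∀ i, ∃ x, ¬ S i ⊆ T i → x ∈ S i ∧ x ∉ T i := by
      intro i
      by_cases hi : S i ⊆ T i
      · exact ⟨x₀, fun h => absurd hi h⟩
      · obtain ⟨x, hx⟩ := Set.not_subset.1 hi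
        exact ⟨x, fun _ => hx⟩
    choose f hf using hex
    have hfT := coe_mem_collapse_coe.1
      (h (coe_mem_collapse_coe.2 (hne.mono fun i hi => (hf i hi).1)))
    obtain ⟨i, hi, hiT⟩ := (hne.and hfT).exists
    exact (hf i hi).2 hiT
  · induction x using Filter.Germ.inductionOn with
    | _ f => exact fun hf => (coe_mem_collapse_coe.1 hf).mp (h.mono fun i hi hfi => hi hfi)

theorem collapse_univ : collapse ((Set.univ : Set X) : Star D (Set X)) = Set.univ := by
  refine Set.eq_univ_of_forall fun x => ?_
  induction x using Filter.Germ.inductionOn with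
  | _ f => exact coe_mem_collapse_coe.2 (.of_forall fun _ => Set.mem_univ _)

end Internal

/-! ### Internal subalgebras -/

section Algebra

variable {σ : Signature.{v, w}} {U : Type u} {A : UrAlgebra σ U} {I : Type z} {D : Ultrafilter I}

/-- Internal tuples are tested on internal entries only; both directions hold since a family of
bad applications, or of bad entries of an application, is itself internal. -/
theorem isStarSubalgebra_collapse_iff {S : I → Set A.carrier} :
    IsStarSubalgebra A D (collapse (S : Star D (Set A.carrier))) ↔
      ∀ᶠ i in (D : Filter I), A.IsSubalgebra (S i) := by
  constructor
  · intro h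
    by_contra hne
    have hne := Ultrafilter.eventually_not.2 hne
    have hbad : ∀ i, ¬ A.IsSubalgebra (S i) →
        ∃ p : Application A, (∀ k, p.2 k ∈ S i) ∧ A.op p.1 p.2 ∉ S i := by
      intro i hi
      simp only [UrAlgebra.IsSubalgebra, not_forall] at hi
      obtain ⟨o, x, hx, hox⟩ := hi
      exact ⟨⟨o, x⟩, hx, hox⟩
    obtain ⟨j, hj⟩ := hne.exists
    have : Nonempty (Application A) := ⟨(hbad j hj).choose⟩
    choose! p hpS hpo using hbad
    have hmem : starOp A D (p : Star D (Application A)) ∈ collapse (S : Star D (Set A.carrier)) := by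
      refine h _ fun a => ?_
      induction a using Filter.Germ.inductionOn with
      | _ f =>
        intro hf
        have hf : ∀ᶠ i in (D : Filter I), f i ∈ Set.range (p i).2 := hf
        refine coe_mem_collapse_coe.2 ((hne.and hf).mono ?_)
        rintro i ⟨hi, k, hk⟩
        exact hk ▸ hpS i hi k
    have hmem : ∀ᶠ i in (D : Filter I), A.op (p i).1 (p i).2 ∈ S i := hmem
    obtain ⟨i, hi, hiS⟩ := (hne.and hmem).exists
    exact hpo i hi hiS
  · intro h t
    induction t using Filter.Germ.inductionOn with
    | _ p =>
      intro hp
      change ∀ᶠ i in (D : Filter I), A.op (p i).1 (p i).2 ∈ S i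
      by_contra hne
      have hne := (Ultrafilter.eventually_not.2 hne).and h
      have hbad : ∀ i, A.op (p i).1 (p i).2 ∉ S i ∧ A.IsSubalgebra (S i) →
          ∃ a ∈ Set.range (p i).2, a ∉ S i := by
        rintro i ⟨hi, hS⟩
        by_contra! hcon
        exact hi (hS _ _ fun k => hcon _ ⟨k, rfl⟩)
      obtain ⟨j, -⟩ := hne.exists
      have : Nonempty A.carrier := ⟨A.op (p j).1 (p j).2⟩
      choose! f hfp hfS using hbad
      have hf : ∀ᶠ i in (D : Filter I), f i ∈ S i := hp (f : Star D A.carrier) (hne.mono hfp)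
      obtain ⟨i, hi, hiS⟩ := (hne.and hf).exists
      exact hfS i hi hiS

theorem extensionMonad_eq_univ_of_finitelyGenerated (hA : A.FinitelyGenerated) :
    extensionMonad A D = Set.univ := by
  obtain ⟨F, hF, hFA⟩ := hA
  refine Set.sInter_eq_univ.2 ?_
  rintro B ⟨⟨s, rfl⟩, hsub, hcoe⟩
  induction s using Filter.Germ.inductionOn with
  | _ S =>
    have hFS : ∀ᶠ i in (D : Filter I), ∀ a ∈ F, a ∈ S i :=
      (Filter.eventually_all_finite hF).2 fun a _ => hcoe a
    refine Set.eq_univ_of_univ_subset ?_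
    rw [← collapse_univ (D := D)]
    refine collapse_subset_collapse_iff.2 ?_
    filter_upwards [isStarSubalgebra_collapse_iff.1 hsub, hFS] with i hi hFi
    exact hFA ▸ A.generated_subset hi hFi

/-- In an enlargement, the standard elements of `*A` lie in a hyperfinite set `[K i]`. -/
theorem IsEnlargement.exists_finite_forall_eventually_mem (hD : IsEnlargement U D)
    (S : Set U) : ∃ K : I → Set S, (∀ᶠ i in (D : Filter I), (K i).Finite) ∧
      ∀ a : S, ∀ᶠ i in (D : Filter I), a ∈ K i := by
  -- Finite subsets of `U` are elements of the level `U ⊕ Set U`.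
  let r : Level U 0 → Level U 1 → Prop := fun x b => ∃ F : Set U, b = Sum.inr F ∧ x ∈ F
  let Q : Set (Level U 1) := {b | ∃ F : Set U, F.Finite ∧ b = Sum.inr F}
  have hconc : IsConcurrent (X := Level U 0) (Y := Level U 1) S Q r := fun C _ hC =>
    ⟨Sum.inr C, ⟨C, hC, rfl⟩, fun x hx => ⟨C, rfl, hx⟩⟩
  obtain ⟨b, hbQ, hb⟩ := hD 0 1 S Q r hconc
  induction b using Filter.Germ.inductionOn with
  | _ f =>
    have hbQ : ∀ᶠ i in (D : Filter I), f i ∈ Q := hbQ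
    refine ⟨fun i => {a | r (a : U) (f i)}, ?_, fun a => hb (a : U) a.2⟩
    filter_upwards [hbQ] with i hi
    obtain ⟨F, hF, hfF⟩ := hi
    refine (hF.preimage (Subtype.val_injective (p := (· ∈ S))).injOn).subset ?_
    rintro a ⟨G, hG, haG⟩
    obtain rfl : F = G := Sum.inr_injective (hfF.symm.trans hG)
    exact haG

theorem finitelyGenerated_of_isInternal_extensionMonad (hD : IsEnlargement U D)
    (h : IsInternal (extensionMonad A D)) : A.FinitelyGenerated := by
  by_contra hA
  obtain ⟨g, hg⟩ := UrAlgebra.exists_forall_finite_not_mapsTo_generated hA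
  obtain ⟨K, hKfin, hK⟩ := hD.exists_finite_forall_eventually_mem A.carrier
  obtain ⟨s, hs⟩ := h
  induction s using Filter.Germ.inductionOn with
  | _ T =>
    have hT : ∀ a, ∀ᶠ i in (D : Filter I), a ∈ T i := by
      intro a
      have ha : (a : Star D A.carrier) ∈ extensionMonad A D := fun B hB => hB.2.2 a
      rw [hs] at ha
      exact ha
    let B : I → Set A.carrier := fun i => {a | a ∈ K i ∧ g a ∈ T i}
    have hB : ∀ a, ∀ᶠ i in (D : Filter I), a ∈ B i := fun a => (hK a).and (hT (g a))
    have hTB : ∀ᶠ i in (D : Filter I), T i ⊆ A.generated (B i) := by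
      refine collapse_subset_collapse_iff.1 (hs ▸ Set.sInter_subset_of_mem ⟨⟨_, rfl⟩, ?_, ?_⟩)
      · exact isStarSubalgebra_collapse_iff.2 (.of_forall fun i => A.isSubalgebra_generated _)
      · exact fun a => (hB a).mono fun i hi => A.subset_generated _ hi
    have hne : Nonempty A.carrier := by
      by_contra hempty
      rw [not_nonempty_iff] at hempty
      exact hA ⟨∅, Set.finite_empty, Subsingleton.elim _ _⟩
    obtain ⟨a⟩ := hne
    obtain ⟨i, ⟨hKi, hai⟩, hTi⟩ := ((hKfin.and (hB a)).and hTB).exists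
    exact hg (B i) (hKi.subset fun b hb => hb.1) ⟨a, hai⟩ fun b hb => hTi hb.2

end Algebra

end ExtensionMonad

theorem mainTheorem3 {U : Type u} {σ : ExtensionMonad.Signature.{v, w}}
    (A : ExtensionMonad.UrAlgebra σ U) {I : Type z} (D : Ultrafilter I)
    (hD : ExtensionMonad.IsEnlargement U D) :
    List.TFAE
      [A.FinitelyGenerated,
       ExtensionMonad.extensionMonad A D = Set.univ,
       ExtensionMonad.IsInternal (ExtensionMonad.extensionMonad A D)] := by
  tfae_have 1 → 2 := ExtensionMonad.extensionMonad_eq_univ_of_finitelyGenerated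
  tfae_have 2 → 3 := fun h => ⟨_, h.trans ExtensionMonad.collapse_univ.symm⟩
  tfae_have 3 → 1 := ExtensionMonad.finitelyGenerated_of_isInternal_extensionMonad hD
  tfae_finish
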